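/- Throughout, a density on $[1,\infty)$ is a measurable $f:\mathbb R\to[0,\infty)$ with $f(x)=0$ for $x<1$ and $\int f=1$. For such $f$ let $X$ have density $f$, put $\mu=\mu_f=E[X^{3/4}]$, let $X_1,X_2,\dots$ be i.i.d. with density $f$ on some probability space, and for $n\ge1$ let $$\hat S_n=\frac1n\sum_{i=1}^nX_i^{3/4},\qquad \hat T_n=\frac1n\sum_{i=1}^nX_i .$$ **Proposition 1.1.** (i) If $f(x)=\frac{5}{2x^{7/2}}$ for $x\ge1$, then for every $\varepsilon>0$, $$\Pr\{\hat S_n-\mu>\varepsilon\}\sim\frac{1}{\varepsilon^{10/3}\,n^{7/3}},\qquad n\to\infty,$$ that is, the ratio of the two sides tends to $1$. (ii) For all $\varepsilon,u>0$ there is a constant $I(\varepsilon,u)>0$, depending only on $\varepsilon$ and $u$, such that for every density $f$ on $[1,\infty)$ with mean $E[X]=5/3$, $$\Pr\{\hat S_n-\mu>\varepsilon\text{ and }|\hat T_n-\tfrac53|<u\}\le e^{-nI(\varepsilon,u)}\qquad\text{for all }n\ge1 .$$ (iii) For every density $f$ on $[1,\infty)$ with mean $5/3$ and variance $20/9$,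 every $\varepsilon>0$ and every $0<u\le\varepsilon/20$, $$\Pr\{\hat S_n-\mu>\varepsilon\text{ and }|\hat T_n-\tfrac53|<u\}\le e^{-0.005\,n\varepsilon^2}\qquad\text{for all }n\ge1 .$$ (iv) For every density $f$ on $[1,\infty)$ with mean $5/3$, variance $20/9$ and $\operatorname{Cov}(X^{3/4},X)=20/21$, every $\varepsilon>0$ and every $0<u\le\varepsilon/20$, $$\Pr\{\hat S_n-\mu>\varepsilon\text{ and }|\hat T_n-\tfrac53|<u\}\le e^{-0.0367\,n\varepsilon^2}\qquad\text{for all }n\ge1 .$$ -/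

import Mathlib

open MeasureTheory ProbabilityTheory Filter

/-- `f` is a probability density on `[1, ∞)` (extended by `0` to the left of `1`). -/
structure IsDensityOnOneInfty (f : ℝ → ℝ) : Prop where
  measurable : Measurable f
  nonneg : ∀ x, 0 ≤ f x
  eq_zero_of_lt_one : ∀ x, x < 1 → f x = 0
  lintegral_eq_one : ∫⁻ x, ENNReal.ofReal (f x) = 1

/-- The law on `ℝ` with density `f` with respect to Lebesgue measure. -/
noncomputable def densityLaw (f : ℝ → ℝ) : Measure ℝ :=
  volume.withDensity fun x => ENNReal.ofReal (f x)

/-- The particular density `f(x) = 5 / (2 x^{7/2})` on `[1, ∞)`. -/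
noncomputable def heavyDensity (x : ℝ) : ℝ :=
  if 1 ≤ x then 5 / (2 * x ^ (7 / 2 : ℝ)) else 0

/-- `X 0, X 1, …` are independent and identically distributed with density `f` on the
probability space `(Ω, P)`. -/
structure IsIIDSample {Ω : Type*} [MeasurableSpace Ω] (P : Measure Ω) (f : ℝ → ℝ)
    (X : ℕ → Ω → ℝ) : Prop where
  indep : iIndepFun X P
  law : ∀ i, HasLaw (X i) (densityLaw f) P

/-- The quantity to be estimated, `μ = E[X^{3/4}]` for `X` with density `f`. -/
noncomputable def targetMean (f : ℝ → ℝ) : ℝ :=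
  ∫ x, x ^ (3 / 4 : ℝ) ∂(densityLaw f)

/-- The standard estimator `Ŝ_n`: the average of the first `n` values of `X_i^{3/4}`. -/
noncomputable def standardEstimator {Ω : Type*} (X : ℕ → Ω → ℝ) (n : ℕ) (ω : Ω) : ℝ :=
  (1 / (n : ℝ)) * ∑ i ∈ Finset.range n, X i ω ^ (3 / 4 : ℝ)

/-- The screening average `T̂_n`: the average of the first `n` samples. -/
noncomputable def screeningAverage {Ω : Type*} (X : ℕ → Ω → ℝ) (n : ℕ) (ω : Ω) : ℝ :=
  (1 / (n : ℝ)) * ∑ i ∈ Finset.range n, X i ω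

/-- The event `{Ŝ_n - μ > ε}`. -/
def standardErrorEvent {Ω : Type*} (f : ℝ → ℝ) (X : ℕ → Ω → ℝ) (n : ℕ) (ε : ℝ) : Set Ω :=
  {ω | standardEstimator X n ω - targetMean f > ε}

/-- The event `{Ŝ_n - μ > ε and |T̂_n - 5/3| < u}`. -/
def screenedErrorEvent {Ω : Type*} (f : ℝ → ℝ) (X : ℕ → Ω → ℝ) (n : ℕ) (ε u : ℝ) : Set Ω :=
  {ω | standardEstimator X n ω - targetMean f > ε ∧ |screeningAverage X n ω - 5 / 3| < u}

/-! The screened bounds come from a one-sided linear trade-off. For `c ≥ 0`, the event forces the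
sum of `X ^ (3/4) - c * X` above `n * (μ + ε - c * (5/3 + u))`. Unlike `X ^ (3/4)`, this summand is
bounded above on `[1, ∞)`, so it has exponential moments and `measureReal_sum_ge_le_exp` applies. A
small `c` makes every constant depend only on `ε` and `u`. With `c = 3/4`, subtracting the tangent
line at `1` leaves a nonpositive variable of explicitly bounded second moment, hence a Gaussian-type
rate.

The unscreened asymptotics are the principle of one big jump. The lower bound
`le_measureReal_sum_gt` uses disjoint events on which a single summand exceeds `(ε + δ) n` while the
others nearly cancel. The upper bound `measureReal_sum_gt_le` leaves two alternatives to a jump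
beyond `(ε - δ) n`: a smaller jump helped by a Chebyshev deviation of the rest, and a large
truncated sum. Both have probability `o(n ^ (1 - α))`, where `n ^ (-α)` is the order of the tail. -/

/-! ### Exponential inequalities and the Chernoff bound. -/

theorem exp_le_one_add_add_sq_mul_exp {x B : ℝ} (hB : 0 ≤ B) (hx : x ≤ B) :
    Real.exp x ≤ 1 + x + x ^ 2 * Real.exp B := by
  have hB1 : 1 ≤ Real.exp B := Real.one_le_exp hB
  have hxB : Real.exp x ≤ Real.exp B := Real.exp_le_exp.2 hx
  rcases le_total |x| 1 with h | h
  · have := (abs_le.1 (Real.abs_exp_sub_one_sub_id_le h)).2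
    nlinarith [sq_nonneg x]
  · have h1 : 1 ≤ x ^ 2 := by nlinarith [sq_abs x]
    rcases le_total 0 x with h0 | h0
    · nlinarith
    · have : Real.exp x ≤ 1 := Real.exp_le_one_iff.2 h0
      have h2 : x ≤ -1 := by rw [abs_of_nonpos h0] at h; linarith
      nlinarith

theorem exp_le_one_add_add_sq {x : ℝ} (hx : x ≤ 1) : Real.exp x ≤ 1 + x + x ^ 2 := by
  rcases le_total 0 x with h0 | h0
  · have := (abs_le.1 (Real.abs_exp_sub_one_sub_id_le (abs_le.2 ⟨by linarith, hx⟩))).2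
    linarith
  · simpa using exp_le_one_add_add_sq_mul_exp le_rfl h0

/-- Chernoff bound for a sum of i.i.d. random variables of the form `g (X i)`, where `exp ∘ g`
is dominated by a function `F` with known integral. -/
theorem measureReal_sum_ge_le_exp {Ω : Type*} [MeasurableSpace Ω] {P : Measure Ω}
    [IsProbabilityMeasure P] {ν : Measure ℝ} [IsProbabilityMeasure ν] {X : ℕ → Ω → ℝ}
    (hind : iIndepFun X P)
    (hlaw : ∀ i, HasLaw (X i) ν P) {g F : ℝ → ℝ} (hg : Measurable g) (hF : Integrable F ν)
    (hgF : ∀ᵐ x ∂ν, Real.exp (g x) ≤ F x) {b : ℝ} (hb : ∫ x, F x ∂ν ≤ Real.exp b)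
    (s : Finset ℕ) (t : ℝ) :
    P.real {ω | t ≤ ∑ i ∈ s, g (X i ω)} ≤ Real.exp (s.card * b - t) := by
  have hexp : Measurable fun x => Real.exp (g x) := by fun_prop
  have hint : Integrable (fun x => Real.exp (g x)) ν := by
    refine hF.mono' hexp.aestronglyMeasurable ?_
    filter_upwards [hgF] with x hx
    rwa [Real.norm_of_nonneg (Real.exp_pos _).le]
  have hle : ∫ x, Real.exp (g x) ∂ν ≤ Real.exp b := (integral_mono_ae hint hF hgF).trans hb
  have hpos : 0 < ∫ x, Real.exp (g x) ∂ν := integral_exp_pos hint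
  have hmgf (i : ℕ) : mgf (fun ω => g (X i ω)) P 1 = ∫ x, Real.exp (g x) ∂ν := by
    simp only [mgf, one_mul]
    exact (hlaw i).integral_comp hexp.aestronglyMeasurable
  have hsum : mgf (∑ i ∈ s, fun ω => g (X i ω)) P 1 = (∫ x, Real.exp (g x) ∂ν) ^ s.card := by
    have hind' : iIndepFun (fun i ω => g (X i ω)) P := hind.comp (fun _ => g) fun _ => hg
    rw [hind'.mgf_sum₀ (fun i => hg.comp_aemeasurable (hlaw i).aemeasurable), Finset.prod_congr rfl
      fun i _ => hmgf i, Finset.prod_const]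
  have hI : Integrable (fun ω => Real.exp (1 * (∑ i ∈ s, fun ω => g (X i ω)) ω)) P := by
    -- A non-integrable function has integral `0` by convention, so a nonzero `mgf` certifies
    -- integrability.
    refine Integrable.of_integral_ne_zero ?_
    change mgf (∑ i ∈ s, fun ω => g (X i ω)) P 1 ≠ 0
    rw [hsum]
    positivity
  have h := measure_ge_le_exp_mul_mgf t zero_le_one hI
  rw [hsum] at h
  simp only [Finset.sum_apply] at h
  refine h.trans ?_
  calc Real.exp (-1 * t) * (∫ x, Real.exp (g x) ∂ν) ^ s.card
      ≤ Real.exp (-1 * t) * Real.exp b ^ s.card := by gcongr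
    _ = _ := by rw [← Real.exp_nat_mul, ← Real.exp_add]; ring_nf

/-! ### Exponential bounds for the screened event. -/

section density

variable {f : ℝ → ℝ}

theorem IsDensityOnOneInfty.isProbabilityMeasure (hf : IsDensityOnOneInfty f) :
    IsProbabilityMeasure (densityLaw f) :=
  ⟨by rw [densityLaw, withDensity_apply _ .univ, Measure.restrict_univ, hf.lintegral_eq_one]⟩

theorem IsDensityOnOneInfty.ae_one_le (hf : IsDensityOnOneInfty f) :
    ∀ᵐ x ∂densityLaw f, 1 ≤ x := by
  rw [densityLaw, ae_withDensity_iff hf.measurable.ennreal_ofReal]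
  refine ae_of_all _ fun x hx => ?_
  by_contra! h
  simp [hf.eq_zero_of_lt_one x h] at hx

theorem rpow_three_fourths_le_self {x : ℝ} (hx : 1 ≤ x) : x ^ (3 / 4 : ℝ) ≤ x := by
  simpa using Real.rpow_le_rpow_of_exponent_le hx (by norm_num : (3 / 4 : ℝ) ≤ 1)

/-- Concavity: the right side is the tangent line at `1`. -/
theorem rpow_three_fourths_le_affine {x : ℝ} (hx : 1 ≤ x) :
    x ^ (3 / 4 : ℝ) ≤ 3 / 4 * x + 1 / 4 := by
  have := rpow_one_add_le_one_add_mul_self (s := x - 1) (by linarith)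
    (by norm_num : (0 : ℝ) ≤ 3 / 4) (by norm_num)
  rw [add_sub_cancel] at this
  linarith

theorem IsDensityOnOneInfty.integrable_rpow (hf : IsDensityOnOneInfty f)
    (hi : Integrable (fun x => x) (densityLaw f)) :
    Integrable (fun x : ℝ => x ^ (3 / 4 : ℝ)) (densityLaw f) := by
  refine hi.mono' (by fun_prop) ?_
  filter_upwards [hf.ae_one_le] with x hx
  rw [Real.norm_of_nonneg (by positivity)]
  exact rpow_three_fourths_le_self hx

theorem IsDensityOnOneInfty.targetMean_le (hf : IsDensityOnOneInfty f)
    (hi : Integrable (fun x => x) (densityLaw f)) :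
    targetMean f ≤ ∫ x, x ∂densityLaw f := by
  refine integral_mono_ae (hf.integrable_rpow hi) hi ?_
  filter_upwards [hf.ae_one_le] with x hx using rpow_three_fourths_le_self hx

theorem IsDensityOnOneInfty.targetMean_nonneg (hf : IsDensityOnOneInfty f) :
    0 ≤ targetMean f := by
  refine integral_nonneg_of_ae ?_
  filter_upwards [hf.ae_one_le] with x hx
  simp only [Pi.zero_apply]
  positivity

/-- On the screened error event, both sums are controlled. -/
theorem screenedErrorEvent_subset {Ω : Type*} {X : ℕ → Ω → ℝ} {n : ℕ} (hn : 1 ≤ n) {ε u c : ℝ}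
    (hc : 0 ≤ c) (d : ℝ) {s : ℝ} (hs : 0 ≤ s) :
    screenedErrorEvent f X n ε u ⊆ {ω | s * (n * (targetMean f + ε - c * (5 / 3 + u) - d)) ≤
      ∑ i ∈ Finset.range n, s * (X i ω ^ (3 / 4 : ℝ) - c * X i ω - d)} := by
  rintro ω ⟨h1, h2⟩
  have hn0 : (0 : ℝ) < n := by exact_mod_cast hn
  have h3 := (abs_lt.1 h2).2
  simp only [standardEstimator, screeningAverage, one_div] at h1 h3
  have h4 : n * (targetMean f + ε) < ∑ i ∈ Finset.range n, X i ω ^ (3 / 4 : ℝ) := by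
    rw [← lt_inv_mul_iff₀ hn0]; linarith
  have h5 : ∑ i ∈ Finset.range n, X i ω < n * (5 / 3 + u) := by
    rw [← inv_mul_lt_iff₀ hn0]; linarith
  simp only [Set.mem_ofPred_eq]
  rw [← Finset.mul_sum, Finset.sum_sub_distrib, Finset.sum_sub_distrib, ← Finset.mul_sum,
    Finset.sum_const, Finset.card_range, nsmul_eq_mul]
  refine mul_le_mul_of_nonneg_left ?_ hs
  nlinarith

/-- With `y = x ^ (1/4)` the left side is `y ^ 3 * (1 - c * y)`: nonpositive once `c * y ≥ 1`, and
at most `y ^ 3 ≤ c ^ (-3)` before that. -/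
theorem rpow_three_fourths_sub_mul_le {x c : ℝ} (hx : 1 ≤ x) (hc : 0 < c) :
    x ^ (3 / 4 : ℝ) - c * x ≤ (c ^ 3)⁻¹ := by
  have hx0 : 0 < x := by linarith
  set y := x ^ (1 / 4 : ℝ) with hy
  have hy0 : 0 < y := by positivity
  have h3 : x ^ (3 / 4 : ℝ) = y ^ 3 := by
    rw [hy, ← Real.rpow_natCast, ← Real.rpow_mul hx0.le]; norm_num
  have h4 : x = y ^ 4 := by
    rw [hy, ← Real.rpow_natCast, ← Real.rpow_mul hx0.le]; norm_num
  rw [h3, h4]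
  rcases le_total 1 (c * y) with h | h
  · have : y ^ 3 - c * y ^ 4 ≤ 0 := by
      have : 0 ≤ y ^ 3 * (c * y - 1) := mul_nonneg (by positivity) (by linarith)
      nlinarith
    exact this.trans (by positivity)
  · have h1 : (c * y) ^ 3 ≤ 1 := pow_le_one₀ (by positivity) h
    have h2 : y ^ 3 ≤ (c ^ 3)⁻¹ := by
      rw [← one_div, le_div_iff₀ (by positivity)]; linarith [mul_pow c y 3]
    have : 0 ≤ c * y ^ 4 := by positivity
    linarith

theorem measureReal_screenedErrorEvent_le {ε u : ℝ} (hε : 0 < ε) (hu : 0 < u) :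
    ∃ I : ℝ, 0 < I ∧
      ∀ f : ℝ → ℝ, IsDensityOnOneInfty f →
        ∫ x, x ∂(densityLaw f) = 5 / 3 →
      ∀ (Ω : Type*) [MeasurableSpace Ω] (P : Measure Ω) [IsProbabilityMeasure P]
        (X : ℕ → Ω → ℝ), IsIIDSample P f X → ∀ n : ℕ, 1 ≤ n →
      P.real (screenedErrorEvent f X n ε u) ≤ Real.exp (-((n : ℝ) * I)) := by
  -- The linear term then costs exactly `ε / 4`. Below, `K` bounds both the summand from above and
  -- `μ` itself, and `s` ensures `s * K ≤ 1` and `s * K ^ 2 ≤ ε / 4`, so the exponent per sample is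
  -- at most `ε s / 4 - 3 ε s / 4`.
  set c : ℝ := ε / (4 * (5 / 3 + u)) with hc
  have hc0 : 0 < c := by positivity
  set K : ℝ := max (c ^ 3)⁻¹ (5 / 3) with hK
  have hK0 : 0 < K := lt_max_of_lt_right (by norm_num)
  set s : ℝ := min (1 / K) (ε / (4 * K ^ 2)) with hs
  have hs0 : 0 < s := lt_min (by positivity) (by positivity)
  have hsK : s * K ≤ 1 := by
    rw [← le_div_iff₀ hK0]; exact min_le_left _ _
  have hsK2 : s * K ^ 2 ≤ ε / 4 := by
    have : s ≤ ε / (4 * K ^ 2) := min_le_right _ _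
    rw [le_div_iff₀ (by positivity)] at this
    linarith
  refine ⟨s * ε / 2, by positivity, fun f hf hmean Ω _ P _ X hX n hn => ?_⟩
  have := hf.isProbabilityMeasure
  have hi : Integrable (fun x => x) (densityLaw f) :=
    Integrable.of_integral_ne_zero (by rw [hmean]; norm_num)
  have hY := hf.integrable_rpow hi
  set μ := targetMean f with hμ
  have hμ0 : 0 ≤ μ := hf.targetMean_nonneg
  have hμ1 : μ ≤ 5 / 3 := hmean ▸ hf.targetMean_le hi
  have hF : Integrable (fun x : ℝ => 1 + s * (x ^ (3 / 4 : ℝ) - μ) + s ^ 2 * K ^ 2)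
      (densityLaw f) :=
    (((integrable_const _).add ((hY.sub (integrable_const _)).const_mul _))).add
      (integrable_const _)
  refine (measureReal_mono (screenedErrorEvent_subset hn hc0.le μ hs0.le)).trans ?_
  refine (measureReal_sum_ge_le_exp (b := s ^ 2 * K ^ 2) hX.indep hX.law
    (g := fun x => s * (x ^ (3 / 4 : ℝ) - c * x - μ)) (by fun_prop) hF ?_ ?_ _ _).trans ?_
  · filter_upwards [hf.ae_one_le] with x hx
    have h1 := rpow_three_fourths_sub_mul_le hx hc0
    have hx0 : 0 ≤ x ^ (3 / 4 : ℝ) := by positivity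
    -- Clipping from below gives `|m| ≤ K` with no second moment of `X`, and keeps `m` below the
    -- centered variable `x ^ (3/4) - μ`, so the linear term integrates to `0`.
    set m := max (x ^ (3 / 4 : ℝ) - c * x - μ) (-μ)
    have hm1 : m ≤ K := max_le (by linarith [le_max_left (c ^ 3)⁻¹ (5 / 3 : ℝ)])
      (by linarith)
    have hm2 : -K ≤ m := by
      have : -μ ≤ m := le_max_right _ _
      linarith [le_max_right (c ^ 3)⁻¹ (5 / 3 : ℝ)]
    have hm3 : m ≤ x ^ (3 / 4 : ℝ) - μ := max_le (by nlinarith) (by linarith)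
    have hm4 : m ^ 2 ≤ K ^ 2 := sq_le_sq' hm2 hm1
    calc Real.exp (s * (x ^ (3 / 4 : ℝ) - c * x - μ)) ≤ Real.exp (s * m) :=
          Real.exp_le_exp.2 (mul_le_mul_of_nonneg_left (le_max_left _ _) hs0.le)
      _ ≤ 1 + s * m + (s * m) ^ 2 := exp_le_one_add_add_sq (by nlinarith)
      _ ≤ _ := by
        rw [mul_pow]
        gcongr
  · rw [integral_add (by fun_prop) (by fun_prop), integral_add (by fun_prop) (by fun_prop),
      integral_const_mul, integral_sub hY (by fun_prop)]
    simp only [integral_const, probReal_univ, one_smul]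
    rw [← targetMean, ← hμ, sub_self, mul_zero, add_zero, add_comm]
    exact Real.add_one_le_exp _
  · rw [Finset.card_range]
    refine Real.exp_le_exp.2 ?_
    have h1 : c * (5 / 3 + u) = ε / 4 := by rw [hc]; field_simp
    rw [h1]
    have h2 : s * (s * K ^ 2) ≤ s * (ε / 4) := mul_le_mul_of_nonneg_left hsK2 hs0.le
    have h3 : (n : ℝ) * (s * (s * K ^ 2)) ≤ n * (s * (ε / 4)) :=
      mul_le_mul_of_nonneg_left h2 n.cast_nonneg
    nlinarith

/-- Let `k` be `x ^ (3/4)` minus its tangent line at `1`. Then `-(3/4) * (x - 1) ≤ k ≤ 0`, so its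
second moment is at most `(9/16) * E[(X - 1) ^ 2] = 3/2`. -/
theorem measureReal_screenedErrorEvent_le_of_variance (hf : IsDensityOnOneInfty f)
    (hmean : ∫ x, x ∂(densityLaw f) = 5 / 3)
    (hvar : variance (fun x : ℝ => x) (densityLaw f) = 20 / 9)
    {Ω : Type*} [MeasurableSpace Ω] {P : Measure Ω} [IsProbabilityMeasure P]
    {X : ℕ → Ω → ℝ} (hX : IsIIDSample P f X) {ε u : ℝ} (hε : 0 < ε) (hu : u ≤ ε / 20)
    {n : ℕ} (hn : 1 ≤ n) :
    P.real (screenedErrorEvent f X n ε u) ≤ Real.exp (-(0.15 * (n * ε ^ 2))) := by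
  have := hf.isProbabilityMeasure
  have hi : Integrable (fun x => x) (densityLaw f) :=
    Integrable.of_integral_ne_zero (by rw [hmean]; norm_num)
  have hY := hf.integrable_rpow hi
  have hL2 : MemLp (fun x : ℝ => x) 2 (densityLaw f) := by
    -- Outside `L²` the real-valued variance is `0` by convention, contradicting `20 / 9`.
    by_contra h
    rw [variance_of_not_memLp (by fun_prop) h] at hvar
    norm_num at hvar
  have hi2 : Integrable (fun x : ℝ => x ^ 2) (densityLaw f) := hL2.integrable_sq
  have hsq : ∫ x, x ^ 2 ∂(densityLaw f) = 5 := by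
    rw [variance_eq_sub hL2] at hvar
    simp only [Pi.pow_apply, hmean] at hvar
    linarith
  set μ := targetMean f with hμ
  -- Near the minimizer of the exponent `(3/2) s ^ 2 - (77/80) ε s` obtained at `u = ε / 20`; its
  -- value here is `-0.15375 ε ^ 2`.
  set s : ℝ := 0.3 * ε with hs
  have hs0 : 0 < s := by positivity
  have hi34 : Integrable (fun x : ℝ => 3 / 4 * x) (densityLaw f) := hi.const_mul _
  have hi2x : Integrable (fun x : ℝ => 2 * x) (densityLaw f) := hi.const_mul _
  have hi34' : Integrable (fun x : ℝ => x ^ (3 / 4 : ℝ) - 3 / 4 * x) (densityLaw f) := hY.sub hi34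
  have hi2x' : Integrable (fun x : ℝ => x ^ 2 - 2 * x) (densityLaw f) := hi2.sub hi2x
  have hY' : Integrable (fun x : ℝ => x ^ (3 / 4 : ℝ) - 3 / 4 * x - 1 / 4) (densityLaw f) :=
    hi34'.sub (integrable_const _)
  have hi2' : Integrable (fun x : ℝ => x ^ 2 - 2 * x + 1) (densityLaw f) :=
    hi2x'.add (integrable_const _)
  have hF : Integrable (fun x : ℝ => 1 + s * (x ^ (3 / 4 : ℝ) - 3 / 4 * x - 1 / 4) +
      s ^ 2 * (9 / 16) * (x ^ 2 - 2 * x + 1)) (densityLaw f) :=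
    ((integrable_const _).add (hY'.const_mul _)).add (hi2'.const_mul _)
  refine (measureReal_mono (screenedErrorEvent_subset hn (by norm_num : (0 : ℝ) ≤ 3 / 4) (1 / 4)
    hs0.le)).trans ?_
  refine (measureReal_sum_ge_le_exp (b := s * (μ - 3 / 2) + s ^ 2 * (3 / 2)) hX.indep hX.law
    (g := fun x => s * (x ^ (3 / 4 : ℝ) - 3 / 4 * x - 1 / 4)) (by fun_prop) hF ?_ ?_ _ _).trans ?_
  · filter_upwards [hf.ae_one_le] with x hx
    have h1 := rpow_three_fourths_le_affine hx
    have h2 : 1 ≤ x ^ (3 / 4 : ℝ) := Real.one_le_rpow hx (by norm_num)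
    set k := x ^ (3 / 4 : ℝ) - 3 / 4 * x - 1 / 4 with hk
    have hk1 : k ≤ 0 := by linarith
    have hk2 : k ^ 2 ≤ 9 / 16 * (x ^ 2 - 2 * x + 1) := by
      have : k ^ 2 ≤ (3 / 4 * (x - 1)) ^ 2 := sq_le_sq' (by linarith) (by linarith)
      linarith
    refine (exp_le_one_add_add_sq (by nlinarith)).trans ?_
    rw [mul_pow, mul_assoc (s ^ 2)]
    gcongr
  · rw [integral_add (by fun_prop) (by fun_prop), integral_add (by fun_prop) (by fun_prop),
      integral_const_mul, integral_const_mul, integral_sub hi34' (by fun_prop),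
      integral_sub hY hi34, integral_add hi2x' (by fun_prop),
      integral_sub hi2 hi2x, integral_const_mul, integral_const_mul, hmean, hsq]
    simp only [integral_const, probReal_univ, one_smul]
    rw [← targetMean, ← hμ]
    refine le_trans (le_of_eq ?_) (Real.add_one_le_exp _)
    ring
  · rw [Finset.card_range]
    refine Real.exp_le_exp.2 ?_
    have h3 : (n : ℝ) * (s * u) ≤ n * (s * (ε / 20)) := by gcongr
    have h4 : (0 : ℝ) ≤ n * ε ^ 2 := by positivity
    simp only [hs] at h3 ⊢
    nlinarith

end density

/-! ### Finite-sample bounds for the one-big-jump principle. -/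

section HeavyTail

open scoped Topology

variable {Ω : Type*} [MeasurableSpace Ω] {P : Measure Ω} {ν : Measure ℝ} {V : ℕ → Ω → ℝ}

theorem measureReal_inter_preimage_eq_mul {Y Z : Ω → ℝ} (h : IndepFun Y Z P) {A B : Set ℝ}
    (hA : MeasurableSet A) (hB : MeasurableSet B) :
    P.real (Y ⁻¹' A ∩ Z ⁻¹' B) = P.real (Y ⁻¹' A) * P.real (Z ⁻¹' B) := by
  simp only [measureReal_def, h.measure_inter_preimage_eq_mul A B hA hB, ENNReal.toReal_mul]

theorem measureReal_preimage_of_hasLaw {Y : Ω → ℝ} (h : HasLaw Y ν P) {A : Set ℝ}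
    (hA : MeasurableSet A) : P.real (Y ⁻¹' A) = ν.real A :=
  h.measureReal_eq (p := fun x => x ∈ A) hA

variable [IsProbabilityMeasure P]

/-- Chebyshev's inequality for a sum of centered i.i.d. random variables. -/
theorem measureReal_le_abs_sum_le (hind : iIndepFun V P) (hlaw : ∀ i, HasLaw (V i) ν P)
    (h2 : MemLp id 2 ν) (h0 : ∫ x, x ∂ν = 0) (s : Finset ℕ) {d : ℝ} (hd : 0 < d) :
    P.real {ω | d ≤ |(∑ i ∈ s, V i) ω|} ≤ s.card * variance id ν / d ^ 2 := by
  have hL (i : ℕ) : MemLp (V i) 2 P := by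
    have := h2
    rw [← (hlaw i).map_eq, memLp_map_measure_iff (by fun_prop) (hlaw i).aemeasurable] at this
    exact this
  have hE : ∫ ω, (∑ i ∈ s, V i) ω ∂P = 0 := by
    simp only [Finset.sum_apply]
    rw [integral_finsetSum _ fun i _ => (hL i).integrable one_le_two]
    exact Finset.sum_eq_zero fun i _ => (hlaw i).integral_eq.trans h0
  have hV : variance (∑ i ∈ s, V i) P = s.card * variance id ν := by
    rw [IndepFun.variance_sum (fun i _ => hL i) fun i _ j _ hij => hind.indepFun hij,
      Finset.sum_congr rfl fun i _ => (hlaw i).variance_eq, Finset.sum_const, nsmul_eq_mul]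
  have h := meas_ge_le_variance_div_sq (memLp_finsetSum' s fun i _ => hL i) hd
  rw [hE, hV] at h
  simp only [sub_zero] at h
  exact ENNReal.toReal_le_of_le_ofReal
    (div_nonneg (mul_nonneg (Nat.cast_nonneg _) (variance_nonneg _ _)) (sq_nonneg _)) h

/-- The truncation from above: `x` if `x ≤ η`, and `0` otherwise. -/
noncomputable def truncateAbove (η x : ℝ) : ℝ := if x ≤ η then x else 0

theorem measurable_truncateAbove (η : ℝ) : Measurable (truncateAbove η) :=
  Measurable.ite measurableSet_Iic measurable_id measurable_const

/-- A sum exceeds `t` only if a summand is close to `t`, or a summand exceeds `η` and the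
others contribute at least `d`, or the sum of the truncated summands is at least `t`. -/
theorem measureReal_sum_gt_le (hind : iIndepFun V P) (hlaw : ∀ i, HasLaw (V i) ν P)
    (h2 : MemLp id 2 ν) (h0 : ∫ x, x ∂ν = 0) (s : Finset ℕ) (t η : ℝ) {d : ℝ} (hd : 0 < d) :
    P.real {ω | t < ∑ i ∈ s, V i ω} ≤ s.card * ν.real (Set.Ioi (t - d)) +
      s.card * (ν.real (Set.Ioi η) * (s.card * variance id ν / d ^ 2)) +
      P.real {ω | t ≤ ∑ i ∈ s, truncateAbove η (V i ω)} := by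
  have hsub : {ω | t < ∑ i ∈ s, V i ω} ⊆
      ((⋃ i ∈ s, V i ⁻¹' Set.Ioi (t - d)) ∪
        ⋃ i ∈ s, (∑ j ∈ s.erase i, V j) ⁻¹' {x | d ≤ |x|} ∩ V i ⁻¹' Set.Ioi η) ∪
      {ω | t ≤ ∑ i ∈ s, truncateAbove η (V i ω)} := by
    intro ω hω
    simp only [Set.mem_ofPred_eq] at hω
    by_cases h1 : ∃ i ∈ s, t - d < V i ω
    · obtain ⟨i, hi, h⟩ := h1
      exact Or.inl (Or.inl (Set.mem_biUnion hi h))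
    by_cases h2 : ∃ i ∈ s, η < V i ω
    · obtain ⟨i, hi, h⟩ := h2
      refine Or.inl (Or.inr (Set.mem_biUnion hi ⟨?_, h⟩))
      push Not at h1
      have h3 := h1 i hi
      rw [← Finset.add_sum_erase _ _ hi] at hω
      simp only [Set.mem_preimage, Set.mem_ofPred_eq, Finset.sum_apply]
      exact le_trans (by linarith) (le_abs_self _)
    · push Not at h2
      refine Or.inr ?_
      simp only [Set.mem_ofPred_eq]
      refine hω.le.trans (Finset.sum_le_sum fun i hi => ?_)
      rw [truncateAbove, if_pos (h2 i hi)]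
  refine (measureReal_mono hsub).trans ((measureReal_union_le _ _).trans ?_)
  gcongr
  refine (measureReal_union_le _ _).trans ?_
  gcongr
  · refine (measureReal_biUnion_finset_le _ _).trans (le_of_eq ?_)
    rw [Finset.sum_congr rfl fun i _ => measureReal_preimage_of_hasLaw (hlaw i) measurableSet_Ioi,
      Finset.sum_const, nsmul_eq_mul]
  · refine (measureReal_biUnion_finset_le _ _).trans ?_
    rw [← nsmul_eq_mul]
    refine Finset.sum_le_card_nsmul _ _ _ fun i hi => ?_
    rw [measureReal_inter_preimage_eq_mul (hind.indepFun_finsetSum_of_notMem₀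
      (fun i => (hlaw i).aemeasurable) (Finset.notMem_erase i s))
      (measurableSet_le measurable_const (by fun_prop)) measurableSet_Ioi, mul_comm,
      measureReal_preimage_of_hasLaw (hlaw i) measurableSet_Ioi]
    gcongr
    refine (measureReal_le_abs_sum_le hind hlaw h2 h0 (s.erase i) hd).trans ?_
    have := variance_nonneg id ν
    have : (s.erase i).card ≤ s.card := Finset.card_le_card (Finset.erase_subset _ _)
    gcongr

/-- A summand above `t + d` suffices when the others sum to less than `d` in absolute value.
Independence and Chebyshev give the first correction; discarding a second jump gives the other. -/
theorem le_measureReal_sum_gt (hind : iIndepFun V P) (hlaw : ∀ i, HasLaw (V i) ν P)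
    (h2 : MemLp id 2 ν) (h0 : ∫ x, x ∂ν = 0) (s : Finset ℕ) (t : ℝ) {d : ℝ} (hd : 0 < d) :
    s.card * (ν.real (Set.Ioi (t + d)) * (1 - s.card * variance id ν / d ^ 2 -
      s.card * ν.real (Set.Ioi (t + d)))) ≤ P.real {ω | t < ∑ i ∈ s, V i ω} := by
  set A : ℕ → Set Ω := fun i => V i ⁻¹' Set.Ioi (t + d) with hA
  set G : ℕ → Set Ω := fun i => (∑ j ∈ s.erase i, V j) ⁻¹' {x | d ≤ |x|}ᶜ with hG
  -- Excluding jumps at all other indices makes these events disjoint, so their probabilities add.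
  set D : ℕ → Set Ω := fun i => (G i ∩ A i) \ ⋃ j ∈ s.erase i, A j with hD
  have hBm : MeasurableSet {x : ℝ | d ≤ |x|} := measurableSet_le measurable_const (by fun_prop)
  have hV (i : ℕ) : AEMeasurable (V i) P := (hlaw i).aemeasurable
  have hS (i : ℕ) : AEMeasurable (∑ j ∈ s.erase i, V j) P :=
    Finset.aemeasurable_sum _ fun i _ => hV i
  have hAm (i : ℕ) : NullMeasurableSet (A i) P :=
    (hV i).nullMeasurableSet_preimage measurableSet_Ioi
  have hGm (i : ℕ) : NullMeasurableSet (G i) P :=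
    (hS i).nullMeasurableSet_preimage hBm.compl
  have hUm (i : ℕ) : NullMeasurableSet (⋃ j ∈ s.erase i, A j) P :=
    Finset.nullMeasurableSet_biUnion _ fun j _ => hAm j
  have hDm (i : ℕ) : NullMeasurableSet (D i) P := ((hGm i).inter (hAm i)).diff (hUm i)
  have hPA (i : ℕ) : P.real (A i) = ν.real (Set.Ioi (t + d)) :=
    measureReal_preimage_of_hasLaw (hlaw i) measurableSet_Ioi
  have hsub : ⋃ i ∈ s, D i ⊆ {ω | t < ∑ i ∈ s, V i ω} := by
    refine Set.iUnion₂_subset fun i hi ω hω => ?_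
    have h1 : t + d < V i ω := hω.1.2
    have h3 : |(∑ j ∈ s.erase i, V j) ω| < d := not_le.1 hω.1.1
    simp only [Set.mem_ofPred_eq]
    rw [← Finset.add_sum_erase _ _ hi]
    rw [Finset.sum_apply] at h3
    linarith [(abs_lt.1 h3).1]
  have hdisj : (s : Set ℕ).Pairwise (Function.onFun (AEDisjoint P) D) := by
    intro i hi j hj hij
    refine Disjoint.aedisjoint (Set.disjoint_left.2 fun ω h h' => h'.2 ?_)
    exact Set.mem_biUnion (Finset.mem_coe.2 (Finset.mem_erase.2 ⟨hij, hi⟩)) h.1.2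
  refine le_trans ?_ (measureReal_mono hsub)
  rw [measureReal_biUnion_finset₀ hdisj fun i _ => hDm i, ← nsmul_eq_mul]
  refine Finset.card_nsmul_le_sum _ _ _ fun i hi => ?_
  have hcard : ((s.erase i).card : ℝ) ≤ s.card :=
    Nat.cast_le.2 (Finset.card_le_card (Finset.erase_subset _ _))
  have hGA : ν.real (Set.Ioi (t + d)) * (1 - s.card * variance id ν / d ^ 2) ≤
      P.real (G i ∩ A i) := by
    rw [measureReal_inter_preimage_eq_mul (hind.indepFun_finsetSum_of_notMem₀
      hV (Finset.notMem_erase i s)) hBm.compl measurableSet_Ioi, mul_comm, ← hPA i]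
    gcongr
    rw [Set.preimage_compl, probReal_compl_eq_one_sub₀ ((hS i).nullMeasurableSet_preimage hBm)]
    have := variance_nonneg id ν
    have := measureReal_le_abs_sum_le hind hlaw h2 h0 (s.erase i) hd
    have h4 : (s.erase i).card * variance id ν / d ^ 2 ≤ s.card * variance id ν / d ^ 2 := by
      gcongr
    have h5 : P.real ((∑ j ∈ s.erase i, V j) ⁻¹' {x | d ≤ |x|}) ≤
      (s.erase i).card * variance id ν / d ^ 2 := this
    linarith
  have hAA : P.real ((G i ∩ A i) ∩ ⋃ j ∈ s.erase i, A j) ≤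
      s.card * (ν.real (Set.Ioi (t + d)) * ν.real (Set.Ioi (t + d))) := by
    calc P.real ((G i ∩ A i) ∩ ⋃ j ∈ s.erase i, A j) ≤ P.real (⋃ j ∈ s.erase i, A i ∩ A j) := by
          refine measureReal_mono ?_ (measure_ne_top _ _)
          rw [← Set.inter_iUnion₂]
          exact Set.inter_subset_inter_left _ Set.inter_subset_right
      _ ≤ ∑ j ∈ s.erase i, P.real (A i ∩ A j) := measureReal_biUnion_finset_le _ _
      _ = (s.erase i).card * (ν.real (Set.Ioi (t + d)) * ν.real (Set.Ioi (t + d))) := by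
          rw [← nsmul_eq_mul, ← Finset.sum_const]
          refine Finset.sum_congr rfl fun j hj => ?_
          rw [← hPA i, hPA i, ← hPA i]
          nth_rw 2 [hPA i]
          rw [← hPA j]
          exact measureReal_inter_preimage_eq_mul
            (hind.indepFun (Finset.ne_of_mem_erase hj).symm) measurableSet_Ioi measurableSet_Ioi
      _ ≤ _ := by gcongr
  have hsplit := measureReal_inter_add_sdiff₀ (μ := P) (s := G i ∩ A i) (hUm i)
  have hDi : P.real (D i) = P.real ((G i ∩ A i) \ ⋃ j ∈ s.erase i, A j) := rfl
  rw [hDi]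
  linarith

variable [IsProbabilityMeasure ν]

/-- Chernoff bound for the sum of the truncated variables. -/
theorem measureReal_sum_truncateAbove_ge_le (hind : iIndepFun V P)
    (hlaw : ∀ i, HasLaw (V i) ν P) (h2 : MemLp id 2 ν) (h0 : ∫ x, x ∂ν = 0) (s : Finset ℕ)
    (t : ℝ) {η r : ℝ} (hη : 0 ≤ η) (hr : 0 < r) :
    P.real {ω | t ≤ ∑ i ∈ s, truncateAbove η (V i ω)} ≤
      Real.exp (s.card * (r ^ 2 * (∫ x, x ^ 2 ∂ν) * Real.exp (r * η)) - r * t) := by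
  have hi : Integrable (fun x : ℝ => x) ν := h2.integrable one_le_two
  have hi2 : Integrable (fun x : ℝ => x ^ 2) ν := h2.integrable_sq
  have hset : {ω | t ≤ ∑ i ∈ s, truncateAbove η (V i ω)} =
      {ω | r * t ≤ ∑ i ∈ s, r * truncateAbove η (V i ω)} := by
    ext ω
    simp only [Set.mem_ofPred_eq]
    rw [← Finset.mul_sum, mul_le_mul_iff_right₀ hr]
  rw [hset]
  have hir : Integrable (fun x : ℝ => r * x) ν := hi.const_mul r
  have hir1 : Integrable (fun x : ℝ => 1 + r * x) ν := (integrable_const 1).add hir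
  have hi2r : Integrable (fun x : ℝ => r ^ 2 * Real.exp (r * η) * x ^ 2) ν := hi2.const_mul _
  refine measureReal_sum_ge_le_exp (F := fun x => 1 + r * x + r ^ 2 * Real.exp (r * η) * x ^ 2)
    hind hlaw ((measurable_truncateAbove η).const_mul r) (hir1.add hi2r)
    (ae_of_all _ fun x => ?_) ?_ s (r * t)
  · have hrη : 0 ≤ r * η := by positivity
    rcases le_or_gt x η with h | h
    · simp only [truncateAbove, if_pos h]
      have := exp_le_one_add_add_sq_mul_exp hrη (mul_le_mul_of_nonneg_left h hr.le)
      linarith [mul_pow r x 2]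
    · simp only [truncateAbove, if_neg h.not_ge, mul_zero, Real.exp_zero]
      have : 0 < x := hη.trans_lt h
      have : 0 ≤ r * x + r ^ 2 * Real.exp (r * η) * x ^ 2 := by positivity
      linarith
  · rw [integral_add hir1 hi2r, integral_add (by fun_prop) hir,
      integral_const_mul, integral_const_mul, h0]
    simp only [integral_const, probReal_univ, one_smul, mul_zero, add_zero]
    refine le_trans (le_of_eq ?_) (Real.add_one_le_exp _)
    ring

end HeavyTail

/-! ### Passage to the limit. -/

section Asymptotics

open scoped Topology

variable {Ω : Type*} [MeasurableSpace Ω] {P : Measure Ω} [IsProbabilityMeasure P]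
  {ν : Measure ℝ} [IsProbabilityMeasure ν] {V : ℕ → Ω → ℝ}

theorem tendsto_inv_mul_exp_log_sq_div_sqrt (C : ℝ) :
    Tendsto (fun n : ℕ => (n : ℝ)⁻¹ * Real.exp (C * (Real.log n ^ 2 / (n : ℝ) ^ (1 / 2 : ℝ))))
      atTop (𝓝 0) := by
  have h1 : Tendsto (fun x : ℝ => Real.log x ^ 2 / x ^ (1 / 2 : ℝ)) atTop (𝓝 0) := by
    simpa using (isLittleO_log_rpow_rpow_atTop 2
      (by norm_num : (0 : ℝ) < 1 / 2)).tendsto_div_nhds_zero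
  have h2 : Tendsto (fun x : ℝ => x⁻¹ * Real.exp (C * (Real.log x ^ 2 / x ^ (1 / 2 : ℝ))))
      atTop (𝓝 (0 * Real.exp (C * 0))) :=
    tendsto_inv_atTop_zero.mul ((Real.continuous_exp.tendsto _).comp (h1.const_mul C))
  rw [zero_mul] at h2
  exact h2.comp tendsto_natCast_atTop_atTop

/-- The truncated sum is negligible at polynomial scale. -/
theorem tendsto_rpow_mul_measureReal_truncated_sum (hind : iIndepFun V P)
    (hlaw : ∀ i, HasLaw (V i) ν P) (h2 : MemLp id 2 ν) (h0 : ∫ x, x ∂ν = 0) {α ε : ℝ}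
    (hα : 0 < α) (hε : 0 < ε) :
    Tendsto (fun n : ℕ => (n : ℝ) ^ (α - 1) * P.real {ω | ε * n ≤
      ∑ i ∈ Finset.range n, truncateAbove (ε / (2 * α) * n) (V i ω)}) atTop (𝓝 0) := by
  refine squeeze_zero' (.of_forall fun n => by positivity) ?_
    (tendsto_inv_mul_exp_log_sq_div_sqrt ((α / ε) ^ 2 * ∫ x, x ^ 2 ∂ν))
  filter_upwards [eventually_ge_atTop 2] with n hn
  have hn0 : (0 : ℝ) < n := by positivity
  have hlog : 0 < Real.log n := Real.log_pos (by exact_mod_cast hn)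
  -- With this Chernoff parameter `r`, `exp (r * t) = n ^ α`, while truncation at `ε n / (2 α)`
  -- gives `exp (r * η) = n ^ (1/2)`. The variance term is then of order `log n ^ 2 / n ^ (1/2)`.
  have hr : 0 < α / ε * Real.log n / n := by positivity
  refine (mul_le_mul_of_nonneg_left (measureReal_sum_truncateAbove_ge_le hind hlaw h2 h0
    (Finset.range n) (ε * n) (η := ε / (2 * α) * n) (by positivity) hr) (by positivity)).trans
    (le_of_eq ?_)
  have h1 : α / ε * Real.log n / n * (ε / (2 * α) * n) = Real.log n * (1 / 2) := by
    field_simp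
  have h3 : α / ε * Real.log n / n * (ε * n) = Real.log n * α := by
    field_simp
  have h4 : (n : ℝ) ^ (α - 1) = (n : ℝ) ^ α * (n : ℝ)⁻¹ := by
    rw [Real.rpow_sub_one hn0.ne', div_eq_mul_inv]
  have h5 : (n : ℝ) ^ (1 / 2 : ℝ) * (n : ℝ) ^ (1 / 2 : ℝ) = n := by
    rw [← Real.rpow_add hn0]; norm_num
  rw [h1, h3, ← Real.rpow_def_of_pos hn0, Real.exp_sub, ← Real.rpow_def_of_pos hn0, h4,
    Finset.card_range]
  have h6 : 0 < (n : ℝ) ^ α := by positivity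
  have h7 : 0 < (n : ℝ) ^ (1 / 2 : ℝ) := by positivity
  have h8 : (n : ℝ) * ((α / ε * Real.log n / n) ^ 2 * (∫ x, x ^ 2 ∂ν) * (n : ℝ) ^ (1 / 2 : ℝ)) =
      (α / ε) ^ 2 * (∫ x, x ^ 2 ∂ν) * (Real.log n ^ 2 / (n : ℝ) ^ (1 / 2 : ℝ)) := by
    rw [eq_comm, ← mul_div_assoc, div_eq_iff h7.ne']
    have : (n : ℝ) * ((α / ε * Real.log n / n) ^ 2 * (∫ x, x ^ 2 ∂ν) * (n : ℝ) ^ (1 / 2 : ℝ)) *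
        (n : ℝ) ^ (1 / 2 : ℝ) = n * ((α / ε * Real.log n / n) ^ 2 * (∫ x, x ^ 2 ∂ν) *
        ((n : ℝ) ^ (1 / 2 : ℝ) * (n : ℝ) ^ (1 / 2 : ℝ))) := by ring
    rw [this, h5]
    field_simp
  rw [h8]
  field_simp

/-- **Large deviations of heavy-tailed sums**: if the tail of a centered square-integrable law is
asymptotic to `c ^ (-α) n ^ (-α)` at `c n`, a sum of `n` i.i.d. copies exceeds `ε n` with
probability asymptotic to `n` times the tail at `ε n`. -/
theorem tendsto_rpow_mul_measureReal_sum_gt (hind : iIndepFun V P)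
    (hlaw : ∀ i, HasLaw (V i) ν P) (h2 : MemLp id 2 ν) (h0 : ∫ x, x ∂ν = 0) {α : ℝ}
    (hα : 1 < α) (htail : ∀ c : ℝ, 0 < c → Tendsto
      (fun n : ℕ => (n : ℝ) ^ α * ν.real (Set.Ioi (c * n))) atTop (𝓝 (c ^ (-α))))
    {ε : ℝ} (hε : 0 < ε) :
    Tendsto (fun n : ℕ => (n : ℝ) ^ (α - 1) *
      P.real {ω | ε * n < ∑ i ∈ Finset.range n, V i ω}) atTop (𝓝 (ε ^ (-α))) := by
  have hα0 : 0 < α := by linarith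
  have hinv : Tendsto (fun n : ℕ => (n : ℝ)⁻¹) atTop (𝓝 0) :=
    tendsto_inv_atTop_zero.comp tendsto_natCast_atTop_atTop
  have hcont : ContinuousAt (fun x : ℝ => x ^ (-α)) ε :=
    Real.continuousAt_rpow_const _ _ (Or.inl hε.ne')
  have hrpow {n : ℕ} (hn : 1 ≤ n) : (n : ℝ) ^ α = (n : ℝ) ^ (α - 1) * n := by
    rw [Real.rpow_sub_one (by positivity), div_mul_cancel₀ _ (by positivity)]
  -- In each direction `δ` is fixed before `n → ∞`; continuity of `x ^ (-α)` at `ε` absorbs the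
  -- shift.
  refine tendsto_order.2 ⟨fun l hl => ?_, fun l hl => ?_⟩
  · have hc : Tendsto (fun δ : ℝ => (ε + δ) ^ (-α)) (𝓝[>] 0) (𝓝 (ε ^ (-α))) := by
      refine (hcont.tendsto.comp (?_ : Tendsto (fun δ : ℝ => ε + δ) (𝓝 0) (𝓝 ε))).mono_left
        nhdsWithin_le_nhds
      simpa using (continuous_const.add continuous_id).tendsto (f := fun δ : ℝ => ε + δ) 0
    obtain ⟨δ, hδl, hδ⟩ := ((hc.eventually_const_lt hl).and self_mem_nhdsWithin).exists
    have hδ0 : 0 < δ := hδ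
    have hT := htail (ε + δ) (by positivity)
    have hdecay : Tendsto (fun n : ℕ => (n : ℝ) ^ (-(α - 1))) atTop (𝓝 0) :=
      (tendsto_rpow_neg_atTop (by linarith)).comp tendsto_natCast_atTop_atTop
    have hlim := hT.mul (((tendsto_const_nhds (x := (1 : ℝ))).sub
      (hinv.const_mul (variance id ν / δ ^ 2))).sub (hdecay.mul hT))
    rw [mul_zero, zero_mul, sub_zero, sub_zero, mul_one] at hlim
    filter_upwards [hlim.eventually_const_lt hδl, eventually_ge_atTop 1] with n hn hn1
    have hn0 : (0 : ℝ) < n := by positivity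
    refine hn.trans_le ?_
    have h := le_measureReal_sum_gt hind hlaw h2 h0 (Finset.range n) (ε * n)
      (d := δ * n) (by positivity)
    refine le_trans (le_of_eq ?_) (mul_le_mul_of_nonneg_left h (by positivity))
    rw [Finset.card_range, ← add_mul, hrpow hn1, Real.rpow_neg hn0.le]
    field_simp
  · have hc : Tendsto (fun δ : ℝ => (ε - δ) ^ (-α)) (𝓝[>] 0) (𝓝 (ε ^ (-α))) := by
      refine (hcont.tendsto.comp (?_ : Tendsto (fun δ : ℝ => ε - δ) (𝓝 0) (𝓝 ε))).mono_left
        nhdsWithin_le_nhds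
      simpa using (continuous_const.sub continuous_id).tendsto (f := fun δ : ℝ => ε - δ) 0
    obtain ⟨δ, hδl, hδ0, hδε⟩ := ((hc.eventually_lt_const hl).and
      (Ioo_mem_nhdsGT hε)).exists
    set η := ε / (2 * α) with hη
    -- The medium-jump term carries an extra `1 / n` from Chebyshev at distance `δ * n`.
    have hlim := ((htail (ε - δ) (by linarith)).add ((htail η (by positivity)).mul
      (hinv.const_mul (variance id ν / δ ^ 2)))).add
      (tendsto_rpow_mul_measureReal_truncated_sum hind hlaw h2 h0 hα0 hε)
    rw [mul_zero, mul_zero, add_zero, add_zero] at hlim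
    filter_upwards [hlim.eventually_lt_const hδl, eventually_ge_atTop 1] with n hn hn1
    have hn0 : (0 : ℝ) < n := by positivity
    refine lt_of_le_of_lt ?_ hn
    have h := measureReal_sum_gt_le hind hlaw h2 h0 (Finset.range n) (ε * n) (η * n)
      (d := δ * n) (by positivity)
    refine (mul_le_mul_of_nonneg_left h (by positivity)).trans (le_of_eq ?_)
    rw [Finset.card_range, ← sub_mul, hrpow hn1, mul_add, mul_add]
    congr 1
    field_simp

end Asymptotics

/-! ### The Pareto density with tail exponent `5/2`. -/

section heavyDensity

open scoped Topology

theorem measurable_heavyDensity : Measurable heavyDensity :=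
  Measurable.ite measurableSet_Ici (by fun_prop) measurable_const

theorem heavyDensity_nonneg (x : ℝ) : 0 ≤ heavyDensity x := by
  rw [heavyDensity]
  split_ifs with h
  · have : 0 ≤ x := by linarith
    positivity
  · rfl

theorem heavyDensity_of_one_le {x : ℝ} (hx : 1 ≤ x) :
    heavyDensity x = 5 / 2 * x ^ (-(7 / 2) : ℝ) := by
  rw [heavyDensity, if_pos hx, Real.rpow_neg (by linarith)]
  field_simp

theorem setLIntegral_heavyDensity_Ioi {b : ℝ} (hb : 1 ≤ b) :
    ∫⁻ x in Set.Ioi b, ENNReal.ofReal (heavyDensity x) = ENNReal.ofReal (b ^ (-(5 / 2) : ℝ)) := by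
  have hb0 : 0 < b := by linarith
  rw [setLIntegral_congr_fun (g := fun x => ENNReal.ofReal (5 / 2 * x ^ (-(7 / 2) : ℝ)))
    measurableSet_Ioi fun x hx => by rw [heavyDensity_of_one_le (hb.trans hx.le)],
    ← ofReal_integral_eq_lintegral_ofReal
      ((integrableOn_Ioi_rpow_of_lt (by norm_num) hb0).const_mul _), integral_const_mul,
    integral_Ioi_rpow_of_lt (by norm_num) hb0]
  · congr 1
    norm_num
    ring_nf
  · filter_upwards [ae_restrict_mem measurableSet_Ioi] with x hx
    have : 0 < x := hb0.trans hx
    simp only [Pi.zero_apply]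
    positivity

theorem isDensityOnOneInfty_heavyDensity : IsDensityOnOneInfty heavyDensity where
  measurable := measurable_heavyDensity
  nonneg := heavyDensity_nonneg
  eq_zero_of_lt_one x hx := if_neg hx.not_ge
  lintegral_eq_one := by
    have h : (fun x => ENNReal.ofReal (heavyDensity x)) =
        (Set.Ici 1).indicator fun x => ENNReal.ofReal (heavyDensity x) := by
      ext x
      by_cases hx : 1 ≤ x
      · rw [Set.indicator_of_mem (Set.mem_Ici.2 hx)]
      · rw [Set.indicator_of_notMem (by simpa using hx), heavyDensity, if_neg hx,
          ENNReal.ofReal_zero]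
    rw [h, lintegral_indicator measurableSet_Ici, setLIntegral_congr Ioi_ae_eq_Ici.symm,
      setLIntegral_heavyDensity_Ioi le_rfl]
    simp

theorem densityLaw_heavyDensity_real_Ioi {b : ℝ} (hb : 1 ≤ b) :
    (densityLaw heavyDensity).real (Set.Ioi b) = b ^ (-(5 / 2) : ℝ) := by
  rw [measureReal_def, densityLaw, withDensity_apply _ measurableSet_Ioi,
    setLIntegral_heavyDensity_Ioi hb, ENNReal.toReal_ofReal (by positivity)]

theorem memLp_rpow_heavyDensity :
    MemLp (fun x : ℝ => x ^ (3 / 4 : ℝ)) 2 (densityLaw heavyDensity) := by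
  rw [memLp_two_iff_integrable_sq (by fun_prop), densityLaw, integrable_withDensity_iff
    measurable_heavyDensity.ennreal_ofReal (ae_of_all _ fun _ => ENNReal.ofReal_lt_top)]
  have h : (fun x : ℝ => (x ^ (3 / 4 : ℝ)) ^ 2 * (ENNReal.ofReal (heavyDensity x)).toReal) =
      (Set.Ici 1).indicator fun x : ℝ => 5 / 2 * x ^ (-2 : ℝ) := by
    ext x
    rw [ENNReal.toReal_ofReal (heavyDensity_nonneg x)]
    by_cases hx : 1 ≤ x
    · have hx0 : 0 < x := by linarith
      rw [Set.indicator_of_mem (Set.mem_Ici.2 hx), heavyDensity_of_one_le hx, ← Real.rpow_mul_natCast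
        hx0.le, mul_left_comm, ← Real.rpow_add hx0]
      norm_num
    · rw [Set.indicator_of_notMem (by simpa using hx), heavyDensity, if_neg hx, mul_zero]
  rw [h, integrable_indicator_iff measurableSet_Ici, integrableOn_Ici_iff_integrableOn_Ioi]
  exact (integrableOn_Ioi_rpow_of_lt (by norm_num) one_pos).const_mul _

theorem densityLaw_heavyDensity_real_rpow_gt {y : ℝ} (hy : 1 ≤ y) :
    (densityLaw heavyDensity).real {x | y < x ^ (3 / 4 : ℝ)} = y ^ (-(10 / 3) : ℝ) := by
  have hy0 : 0 < y := by linarith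
  have h : {x : ℝ | y < x ^ (3 / 4 : ℝ)} =ᵐ[densityLaw heavyDensity]
      Set.Ioi (y ^ (4 / 3 : ℝ)) := by
    filter_upwards [isDensityOnOneInfty_heavyDensity.ae_one_le] with x hx
    refine propext ?_
    change y < x ^ (3 / 4 : ℝ) ↔ y ^ (4 / 3 : ℝ) < x
    have hx0 : 0 ≤ x := by linarith
    rw [← Real.rpow_lt_rpow_iff hy0.le (by positivity) (by norm_num : (0 : ℝ) < 4 / 3),
      ← Real.rpow_mul hx0]
    norm_num
  rw [measureReal_congr h, densityLaw_heavyDensity_real_Ioi (Real.one_le_rpow hy (by norm_num)),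
    ← Real.rpow_mul hy0.le]
  norm_num

theorem isEquivalent_standardErrorEvent_heavyDensity {Ω : Type*} [MeasurableSpace Ω]
    {P : Measure Ω} [IsProbabilityMeasure P] {X : ℕ → Ω → ℝ}
    (hX : IsIIDSample P heavyDensity X) {ε : ℝ} (hε : 0 < ε) :
    Asymptotics.IsEquivalent atTop
      (fun n : ℕ => P.real (standardErrorEvent heavyDensity X n ε))
      (fun n : ℕ => 1 / (ε ^ (10 / 3 : ℝ) * (n : ℝ) ^ (7 / 3 : ℝ))) := by
  have := isDensityOnOneInfty_heavyDensity.isProbabilityMeasure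
  set L := densityLaw heavyDensity with hL
  set μ := targetMean heavyDensity with hμ
  have hμ0 : 0 ≤ μ := isDensityOnOneInfty_heavyDensity.targetMean_nonneg
  set g : ℝ → ℝ := fun x => x ^ (3 / 4 : ℝ) - μ with hg
  have hgm : Measurable g := by fun_prop
  have hgL : MemLp g 2 L := memLp_rpow_heavyDensity.sub (memLp_const μ)
  have hνp : IsProbabilityMeasure (L.map g) := Measure.isProbabilityMeasure_map hgm.aemeasurable
  have hgν : HasLaw g (L.map g) L := ⟨hgm.aemeasurable, rfl⟩
  have h2 : MemLp id 2 (L.map g) :=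
    (memLp_map_measure_iff (by fun_prop) hgm.aemeasurable).2 hgL
  have h0 : ∫ x, x ∂(L.map g) = 0 := by
    rw [← hgν.integral_eq, hg, integral_sub (memLp_rpow_heavyDensity.integrable one_le_two)
      (by fun_prop)]
    simp only [integral_const, probReal_univ, one_smul]
    exact sub_self _
  -- The exponent is `10/3 = (5/2) * (4/3)`. Centering only replaces `c` by `c + μ / n`, which
  -- disappears in the limit.
  have htail (c : ℝ) (hc : 0 < c) : Tendsto (fun n : ℕ => (n : ℝ) ^ (10 / 3 : ℝ) *
      (L.map g).real (Set.Ioi (c * n))) atTop (𝓝 (c ^ (-(10 / 3) : ℝ))) := by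
    have h1 : Tendsto (fun n : ℕ => c + μ * (n : ℝ)⁻¹) atTop (𝓝 (c + μ * 0)) :=
      ((tendsto_inv_atTop_zero.comp tendsto_natCast_atTop_atTop).const_mul μ).const_add c
    rw [mul_zero, add_zero] at h1
    refine ((Real.continuousAt_rpow_const c (-(10 / 3)) (Or.inl hc.ne')).tendsto.comp h1).congr' ?_
    have h3 : ∀ᶠ n : ℕ in atTop, 1 ≤ c * (n : ℝ) :=
      (tendsto_natCast_atTop_atTop.const_mul_atTop hc).eventually_ge_atTop 1
    filter_upwards [h3, eventually_ge_atTop 1] with n hn hn1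
    have hn0 : (0 : ℝ) < n := by positivity
    have hset : g ⁻¹' Set.Ioi (c * n) = {x | c * n + μ < x ^ (3 / 4 : ℝ)} := by
      ext x
      exact lt_sub_iff_add_lt (a := c * n) (b := μ) (c := x ^ (3 / 4 : ℝ))
    rw [map_measureReal_apply hgm measurableSet_Ioi, hset,
      densityLaw_heavyDensity_real_rpow_gt (by linarith)]
    have h4 : c + μ * (n : ℝ)⁻¹ = (c * n + μ) * (n : ℝ)⁻¹ := by field_simp
    simp only [Function.comp_apply]
    rw [h4, Real.mul_rpow (by positivity) (by positivity), Real.inv_rpow hn0.le,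
      Real.rpow_neg hn0.le, inv_inv, mul_comm]
  have hlim := tendsto_rpow_mul_measureReal_sum_gt (V := fun i ω => g (X i ω))
    (hX.indep.comp (fun _ => g) fun _ => hgm) (fun i => hgν.comp (hX.law i)) h2 h0
    (by norm_num) htail hε
  refine Asymptotics.isEquivalent_of_tendsto_one ?_
  have hlim' := hlim.const_mul (ε ^ (10 / 3 : ℝ))
  rw [← Real.rpow_add hε, add_neg_cancel, Real.rpow_zero] at hlim'
  refine hlim'.congr' ?_
  filter_upwards [eventually_ge_atTop 1] with n hn
  have hn0 : (0 : ℝ) < n := by positivity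
  have hset : standardErrorEvent heavyDensity X n ε =
      {ω | ε * n < ∑ i ∈ Finset.range n, g (X i ω)} := by
    ext ω
    simp only [standardErrorEvent, standardEstimator, hg, Set.mem_ofPred_eq, ← hμ, one_div]
    rw [Finset.sum_sub_distrib, Finset.sum_const, Finset.card_range, nsmul_eq_mul, gt_iff_lt,
      lt_sub_iff_add_lt, lt_inv_mul_iff₀ hn0, lt_sub_iff_add_lt, mul_add, mul_comm (n : ℝ) ε]
  rw [Pi.div_apply, hset, div_div_eq_mul_div, div_one]
  norm_num
  ring

end heavyDensity

theorem proposition1p1 :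
    -- (i)
    (∀ (Ω : Type*) [MeasurableSpace Ω] (P : Measure Ω) [IsProbabilityMeasure P]
        (X : ℕ → Ω → ℝ), IsIIDSample P heavyDensity X → ∀ ε : ℝ, 0 < ε →
      Asymptotics.IsEquivalent atTop
        (fun n : ℕ => P.real (standardErrorEvent heavyDensity X n ε))
        (fun n : ℕ => 1 / (ε ^ (10 / 3 : ℝ) * (n : ℝ) ^ (7 / 3 : ℝ)))) ∧
    -- (ii)
    (∀ ε u : ℝ, 0 < ε → 0 < u → ∃ I : ℝ, 0 < I ∧
      ∀ f : ℝ → ℝ, IsDensityOnOneInfty f →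
        ∫ x, x ∂(densityLaw f) = 5 / 3 →
      ∀ (Ω : Type*) [MeasurableSpace Ω] (P : Measure Ω) [IsProbabilityMeasure P]
        (X : ℕ → Ω → ℝ), IsIIDSample P f X → ∀ n : ℕ, 1 ≤ n →
      P.real (screenedErrorEvent f X n ε u) ≤ Real.exp (-((n : ℝ) * I))) ∧
    -- (iii)
    (∀ f : ℝ → ℝ, IsDensityOnOneInfty f →
        ∫ x, x ∂(densityLaw f) = 5 / 3 →
        variance (fun x : ℝ => x) (densityLaw f) = 20 / 9 →
      ∀ (Ω : Type*) [MeasurableSpace Ω] (P : Measure Ω) [IsProbabilityMeasure P]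
        (X : ℕ → Ω → ℝ), IsIIDSample P f X →
      ∀ ε u : ℝ, 0 < ε → 0 < u → u ≤ ε / 20 → ∀ n : ℕ, 1 ≤ n →
      P.real (screenedErrorEvent f X n ε u) ≤ Real.exp (-(0.005 * ((n : ℝ) * ε ^ 2)))) ∧
    -- (iv)
    (∀ f : ℝ → ℝ, IsDensityOnOneInfty f →
        ∫ x, x ∂(densityLaw f) = 5 / 3 →
        variance (fun x : ℝ => x) (densityLaw f) = 20 / 9 →
        covariance (fun x : ℝ => x ^ (3 / 4 : ℝ)) (fun x : ℝ => x) (densityLaw f) = 20 / 21 →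
      ∀ (Ω : Type*) [MeasurableSpace Ω] (P : Measure Ω) [IsProbabilityMeasure P]
        (X : ℕ → Ω → ℝ), IsIIDSample P f X →
      ∀ ε u : ℝ, 0 < ε → 0 < u → u ≤ ε / 20 → ∀ n : ℕ, 1 ≤ n →
      P.real (screenedErrorEvent f X n ε u) ≤ Real.exp (-(0.0367 * ((n : ℝ) * ε ^ 2)))) := by
  -- The rate `0.15` exceeds both `0.005` and `0.0367`, so one estimate yields the last two claims.
  have hexp {c : ℝ} (hc : c ≤ 0.15) (n : ℕ) (ε : ℝ) :
      Real.exp (-(0.15 * (n * ε ^ 2))) ≤ Real.exp (-(c * (n * ε ^ 2))) := by gcongr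
  refine ⟨fun Ω _ P _ X hX ε hε => isEquivalent_standardErrorEvent_heavyDensity hX hε,
    fun ε u hε hu => measureReal_screenedErrorEvent_le hε hu, ?_, ?_⟩
  · intro f hf hmean hvar Ω _ P _ X hX ε u hε _ huε n hn
    exact (measureReal_screenedErrorEvent_le_of_variance hf hmean hvar hX hε huε hn).trans
      (hexp (by norm_num) n ε)
  · intro f hf hmean hvar _ Ω _ P _ X hX ε u hε _ huε n hn
    exact (measureReal_screenedErrorEvent_le_of_variance hf hmean hvar hX hε huε hn).trans
      (hexp (by norm_num) n ε)
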